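/- Let $T=(V,E)$ be a finite tree. For a labeling $\boldsymbol y\in\{-1,+1\}^V$, its cutsize $\Phi_T(\boldsymbol y)$ is the number of edges $(i,j)\in E$ with $y_i\neq y_j$. For $L\subseteq V$, a node $i\in V\setminus L$ is a fork node generated by $L$ if it is connected to three distinct nodes of $L$ through pairwise edge-disjoint paths; $L^+$ denotes $L$ together with all fork nodes generated by $L$. The selection algorithm SEL starts from $L_0=\emptyset$. At step $t$ it takes a largest connected component $T^t_{\max}$ of $T\setminus L_{t-1}$, picks in it a node $i_t$ that minimizes over $i\in T^t_{\max}$ the size of the largest connected component of $T^t_{\max}\setminus\{i\}$, and sets $L_t=L_{t-1}\cup\{i_t\}$ (ties broken arbitrarily). Let $L_{\mathrm{SEL}}$ be the set obtained after any number of steps; the query set returned is $L^+_{\mathrm{SEL}}$. The predictor PRED, given the labels on $L^+_{\mathrm{SEL}}$, predicts on each connected component $\mathcal T$ of $T\setminus L^+_{\mathrm{SEL}}$ as follows. The connection nodes of $\mathcal T$ are the nodes of $L^+_{\mathrm{SEL}}$ adjacent to a node of $\mathcal T$ (there are at most two). If $\mathcal T$ has exactly one connection node, or two with equal labels, then all nodes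 of $\mathcal T$ are predicted with that label. If it has two connection nodes with different labels, then either all nodes of $\mathcal T$ are predicted with the label of one and the same connection node, or each node of $\mathcal T$ is predicted with the label of the connection node closer to it (ties broken arbitrarily); the claim holds for every such version of PRED. (A component without connection nodes occurs only if $L_{\mathrm{SEL}}=\emptyset$; the predictions on it are then arbitrary.) For an integer $K\ge 0$, let $m_{\mathrm{PRED}}(L^+_{\mathrm{SEL}},K)$ be the maximum, over all labelings $\boldsymbol y$ with $\Phi_T(\boldsymbol y)\le K$, of the number of nodes of $V\setminus L^+_{\mathrm{SEL}}$ on which PRED errs. For $L\subseteq V$, let $\mathrm{LB}(L,K)=\sup_{D}\inf_{A}\mathbb E[m_A(L,\boldsymbol y)]$. Here $D$ ranges over the probability distributions on labelings of cutsize at most $K$, $A$ ranges over all (possibly randomized) prediction algorithms that observe only the labels of the nodes in $L$, $m_A(L,\boldsymbol y)$ is the number of mistakes of $A$ on $V\setminus L$, and the expectation is over $\boldsymbol y\sim D$ and the randomness of $A$. Theorem. For every finite tree $T$, every integer $K\ge0$, every set $L_{\mathrm{SEL}}$ produced by SEL, and every $L\subseteq V$ with $|L|\le\frac18|L^+_{\mathrm{SEL}}|$,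 $$m_{\mathrm{PRED}}(L^+_{\mathrm{SEL}},K)\le 10\,\mathrm{LB}(L,K).$$ -/

import Mathlib

namespace TreeQuery

/-- The cutsize of the labeling `y`: the number of edges whose endpoints get different labels.
The two labels `-1`, `+1` are represented by the Booleans throughout. -/
noncomputable def cutsize {V : Type*} (T : SimpleGraph V) (y : V → Bool) : ℕ :=
  {e : Sym2 V | ∃ i j : V, e = s(i, j) ∧ T.Adj i j ∧ y i ≠ y j}.ncard

/-- `i` is a fork node generated by `L`: it is outside `L` and is connected to three distinct
nodes of `L` through pairwise edge disjoint paths. -/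
def IsFork {V : Type*} (T : SimpleGraph V) (L : Set V) (i : V) : Prop :=
  i ∉ L ∧ ∃ i₁ i₂ i₃ : V, i₁ ∈ L ∧ i₂ ∈ L ∧ i₃ ∈ L ∧ i₁ ≠ i₂ ∧ i₁ ≠ i₃ ∧ i₂ ≠ i₃ ∧
    ∃ (p₁ : T.Walk i i₁) (p₂ : T.Walk i i₂) (p₃ : T.Walk i i₃),
      p₁.IsPath ∧ p₂.IsPath ∧ p₃.IsPath ∧
      p₁.edges.Disjoint p₂.edges ∧ p₁.edges.Disjoint p₃.edges ∧ p₂.edges.Disjoint p₃.edges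

/-- `L⁺`: the set `L` together with all the fork nodes it generates. -/
def plus {V : Type*} (T : SimpleGraph V) (L : Set V) : Set V :=
  L ∪ {i | IsFork T L i}

/-- `C` is the node set of a connected component of the forest `T ∖ S`. -/
def IsComponent {V : Type*} (T : SimpleGraph V) (S C : Set V) : Prop :=
  ∃ c : (T.induce Sᶜ).ConnectedComponent, C = Subtype.val '' c.supp

/-- `σ(T', i)`, for the subtree `T'` of `T` with node set `C`: the number of nodes of the largest
component of `T' ∖ {i}` (zero if there is none). -/
noncomputable def sigma {V : Type*} (T : SimpleGraph V) (C : Set V) (i : V) : ℕ :=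
  sSup {m | ∃ D : Set V, IsComponent T (Cᶜ ∪ {i}) D ∧ m = D.ncard}

/-- `SelRun T L`: the set `L` can be the set of nodes chosen by the selection algorithm after some
number of steps. Each step takes a largest component `C` of `T ∖ L` and adds a node `i` of `C`
minimizing `σ(C, i)`; all ties are broken arbitrarily. -/
inductive SelRun {V : Type*} (T : SimpleGraph V) : Set V → Prop
  | start : SelRun T ∅
  | step {L C : Set V} {i : V} : SelRun T L →
      IsComponent T L C → (∀ C' : Set V, IsComponent T L C' → C'.ncard ≤ C.ncard) →
      i ∈ C → (∀ j ∈ C, sigma T C i ≤ sigma T C j) →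
      SelRun T (insert i L)

/-- A hinge-tree of the query set `L` (its node set): a component of `T ∖ L⁺`. -/
def IsHingeTree {V : Type*} (T : SimpleGraph V) (L C : Set V) : Prop :=
  IsComponent T (plus T L) C

/-- The connection nodes of the hinge-tree with node set `C`. -/
def connNodes {V : Type*} (T : SimpleGraph V) (L C : Set V) : Set V :=
  {c | c ∈ L ∧ ∃ i ∈ C, T.Adj c i}

/-- The number of nodes outside the query set `L` where the prediction `p` differs from `y`. -/
noncomputable def mistakes {V : Type*} (L : Set V) (p y : V → Bool) : ℕ :=
  {i | i ∉ L ∧ p i ≠ y i}.ncard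

/-- A deterministic predictor for the query set `L`: it sees the labels on `L` only. -/
abbrev Predictor {V : Type*} (L : Set V) : Type _ := (L → Bool) → (V → Bool)

/-- A randomized predictor for the query set `L`: it sees the labels on `L` only. -/
abbrev RandPredictor {V : Type*} (L : Set V) : Type _ := (L → Bool) → PMF (V → Bool)

/-- `A` is a version of the mincut predictor for the query set `L`. The rule reads `y` on the
connection nodes only. When a 2-hinge-tree has differently labeled connection nodes `c`, `c'`,
"the label of the closer connection node" is admitted in both of its senses: for the hinge-tree
as a whole (both connection nodes are adjacent to it, so that this is a tie), or for each
of its nodes separately. Ties are broken arbitrarily. -/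
def IsPred {V : Type*} (T : SimpleGraph V) (L : Set V) (A : Predictor L) : Prop :=
  ∀ (y : V → Bool) (C : Set V), IsHingeTree T L C →
    (∀ c : V, connNodes T L C = {c} → ∀ i ∈ C, A (L.domRestrict y) i = y c) ∧
    (∀ c c' : V, c ≠ c' → connNodes T L C = {c, c'} → y c = y c' →
      ∀ i ∈ C, A (L.domRestrict y) i = y c) ∧
    (∀ c c' : V, c ≠ c' → connNodes T L C = {c, c'} → y c ≠ y c' →
      (∀ i ∈ C, A (L.domRestrict y) i = y c) ∨
      (∀ i ∈ C, A (L.domRestrict y) i = y c') ∨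
      (∀ i ∈ C, (T.dist i c < T.dist i c' → A (L.domRestrict y) i = y c) ∧
        (T.dist i c' < T.dist i c → A (L.domRestrict y) i = y c')))

/-- `m_A(L, K)`: the maximal number of mistakes of the predictor `A` with query set `L` over the
labelings of cutsize at most `K`. -/
noncomputable def worstMistakes {V : Type*} (T : SimpleGraph V) (L : Set V) (A : Predictor L)
    (K : ℕ) : ENNReal :=
  ⨆ (y : V → Bool) (_ : cutsize T y ≤ K), (mistakes L (A (L.domRestrict y)) y : ENNReal)

/-- The expected number of mistakes of the randomized predictor `A` with query set `L` when the
labeling is drawn from `D`. -/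
noncomputable def expMistakes {V : Type*} (L : Set V) (A : RandPredictor L)
    (D : PMF (V → Bool)) : ENNReal :=
  ∑' y : V → Bool, D y * ∑' p : V → Bool, A (L.domRestrict y) p * (mistakes L p y : ENNReal)

/-- `LB(L, K)`: the largest expected number of mistakes that an adversary, who draws a labeling
of cutsize at most `K` at random, can force on every randomized predictor with query set `L`
(the predictor may depend on `T`, `L`, `K` and on the adversary's distribution). -/
noncomputable def lowerBound {V : Type*} (T : SimpleGraph V) (L : Set V) (K : ℕ) : ENNReal :=
  ⨆ (D : PMF (V → Bool)) (_ : ∀ y ∈ D.support, cutsize T y ≤ K),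
    ⨅ A : RandPredictor L, expMistakes L A D

end TreeQuery

namespace TreeQuery

open SimpleGraph
open scoped ENNReal

variable {V : Type*} {T : SimpleGraph V}


/-! A hinge-tree on which PRED errs touches a cut edge: with one label on it and its connection
nodes, every version of the rule is correct. Different hinge-trees touch different cut edges, so at
most $K$ of them contain errors, and all their nodes may be counted as mistakes.

The lower bound comes from regions. If $R$ avoids $L$ and at most $2K$ edges leave it, divide these
edges into two sets of at most $K$. In a tree each set is the cut of a labeling, and the two
labelings can be taken to agree off $R$ and differ everywhere on $R$. A fair choice between them
forces $|R|/2$ expected mistakes, so $|R|\le 2\,\mathrm{LB}(L,K)$ (`ncard_le_two_mul_lowerBound`).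

A hinge-tree has at most two leaving edges, since a third would create a fork node inside it. The
union of the erroneous hinge-trees avoiding $L$ is thus such a region and costs $2\,\mathrm{LB}$.
Let $k\le\min(K,|L|)$ hinge-trees be hit by $L$. They are paid for by other regions. Each selected
node owns a part: itself and the components it left over in which nothing was selected later. If at
most one of its components was entered later, its part has at least half the size of any remaining
component, because SEL takes largest components and splits them in half (`SelPartition.step`). One
node generates at most one new fork, so $|L^+_{\mathrm{SEL}}|\le 2|L_{\mathrm{SEL}}|$ and
$|L|\le|L_{\mathrm{SEL}}|/4$. Counting then gives $\lceil k/2\rceil$ such parts avoiding $L$ with at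
most $2k$ leaving edges altogether (`SelPartition.exists_region`). Their union has at least a
quarter of the size of the $k$ hinge-trees, which costs $8\,\mathrm{LB}$. -/

/-! ### Separation in trees and fork nodes -/

/-- Every walk from `u` to `w` visits `i`. -/
def Separates (T : SimpleGraph V) (i u w : V) : Prop :=
  ∀ p : T.Walk u w, i ∈ p.support

theorem Separates.symm {i u w : V} (h : Separates T i u w) : Separates T i w u := fun p => by
  simpa using h p.reverse

theorem not_separates_trans {i u v w : V} (h₁ : ¬ Separates T i u v) (h₂ : ¬ Separates T i v w) :
    ¬ Separates T i u w := by
  simp only [Separates, not_forall] at *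
  obtain ⟨p, hp⟩ := h₁
  obtain ⟨q, hq⟩ := h₂
  exact ⟨p.append q, by simp [Walk.mem_support_append_iff, hp, hq]⟩

theorem not_separates_self {i u : V} (h : i ≠ u) : ¬ Separates T i u u := fun hs => by
  simpa [h] using hs Walk.nil

theorem separates_of_isPath (hT : T.IsAcyclic) {u w i : V} {p : T.Walk u w} (hp : p.IsPath)
    (hi : i ∈ p.support) : Separates T i u w := fun q => by
  classical
  have h : p = q.bypass := congrArg Subtype.val
    ((hT.subsingleton_path u w).elim ⟨p, hp⟩ ⟨_, q.bypass_isPath⟩)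
  rw [h] at hi
  exact q.support_bypass_subset_support hi

theorem isPath_append {u v w : V} {p : T.Walk u v} {q : T.Walk v w} (hp : p.IsPath) (hq : q.IsPath)
    (h : ∀ z ∈ p.support, z ∈ q.support → z = v) : (p.append q).IsPath := by
  rw [Walk.isPath_def, Walk.support_append]
  refine List.Nodup.append hp.support_nodup hq.support_nodup.tail fun z hz hz' => ?_
  have hq' := hq.support_nodup
  have := h z hz (List.mem_of_mem_tail hz')
  subst this
  rw [← Walk.cons_tail_support] at hq'
  exact (List.nodup_cons.1 hq').1 hz'

/-- The part of a walk before it first meets the set `P`. -/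
theorem exists_first_hit {u w : V} (q : T.Walk u w) (P : Set V) (hw : w ∈ P) :
    ∃ i ∈ P, ∃ r : T.Walk u i, (∀ z ∈ r.support, z ∈ P → z = i) ∧ r.support ⊆ q.support := by
  induction q with
  | nil => exact ⟨_, hw, Walk.nil, by simp, by simp⟩
  | @cons u v w h q ih =>
    by_cases hu : u ∈ P
    · exact ⟨u, hu, Walk.nil, by simp, by simp⟩
    · obtain ⟨i, hi, r, hr, hs⟩ := ih hw
      refine ⟨i, hi, Walk.cons h r, ?_, ?_⟩
      · intro z hz hzP
        rw [Walk.support_cons, List.mem_cons] at hz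
        rcases hz with rfl | hz
        · exact absurd hzP hu
        · exact hr z hz hzP
      · rw [Walk.support_cons, Walk.support_cons]
        exact List.cons_subset_cons _ hs

/-- The median is the point where a walk from `c` first hits the path from `a` to `b`. -/
theorem exists_median (hT : T.IsTree) (a b c : V) :
    ∃ i, Separates T i a b ∧ Separates T i a c ∧ Separates T i b c := by
  classical
  obtain ⟨p, hp⟩ := hT.connected.exists_isPath a b
  obtain ⟨q, -⟩ := hT.connected.exists_isPath c a
  obtain ⟨i, hi, r, hr, -⟩ := exists_first_hit q {z | z ∈ p.support} (by simp)
  have hi' : i ∈ p.support := hi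
  have key : ∀ z ∈ r.bypass.support, z ∈ p.support → z = i := fun z hz hzp =>
    hr z (r.support_bypass_subset_support hz) hzp
  refine ⟨i, separates_of_isPath hT.isAcyclic hp hi, Separates.symm ?_, Separates.symm ?_⟩
  · refine separates_of_isPath hT.isAcyclic (p := r.bypass.append (p.takeUntil i hi').reverse)
      (isPath_append r.bypass_isPath (hp.takeUntil hi').reverse fun z hz hz' => key z hz ?_)
      (by simp)
    exact p.support_takeUntil_subset_support hi' (by simpa using hz')
  · refine separates_of_isPath hT.isAcyclic (p := r.bypass.append (p.dropUntil i hi'))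
      (isPath_append r.bypass_isPath (hp.dropUntil hi') fun z hz hz' => key z hz ?_) (by simp)
    exact p.support_dropUntil_subset_support hi' hz'

/-- A walk from `u` to `w` avoiding `i` would join the second nodes of the two paths off `i`.
Acyclicity makes these nodes equal, so the paths share their first edge. -/
theorem separates_of_edges_disjoint (hT : T.IsAcyclic) {i u w : V} (hu : i ≠ u) (hw : i ≠ w)
    {p : T.Walk i u} {q : T.Walk i w} (hp : p.IsPath) (hq : q.IsPath)
    (h : p.edges.Disjoint q.edges) : Separates T i u w := by
  classical
  intro r
  by_contra hr
  cases p with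
  | nil => exact hu rfl
  | @cons _ a _ ha p =>
    cases q with
    | nil => exact hw rfl
    | @cons _ b _ hb q =>
      rw [Walk.cons_isPath_iff] at hp hq
      let s : T.Walk a b := (p.append r).append q.reverse
      have hs : i ∉ s.support := by
        simp [s, Walk.mem_support_append_iff, hp.2, hq.2, hr]
      have hpath : (Walk.cons ha s.bypass).IsPath :=
        (Walk.cons_isPath_iff _ _).2 ⟨s.bypass_isPath, fun hi => hs (s.support_bypass_subset_support hi)⟩
      have hmem := separates_of_isPath (i := a) hT hpath (by simp) (Walk.cons hb Walk.nil)
      have hab : a = b := by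
        simpa [ha.ne'] using hmem
      subst hab
      exact h (a := s(i, a)) (by simp) (by simp)

theorem edges_disjoint_of_separates {i u w : V} (h : Separates T i u w)
    {p : T.Walk i u} {q : T.Walk i w} (hp : p.IsPath) (hq : q.IsPath) :
    p.edges.Disjoint q.edges := by
  classical
  have key : ∀ z, z ≠ i → z ∈ p.support → z ∈ q.support → False := by
    have aux : ∀ {z x : V} {p : T.Walk i x}, p.IsPath → z ≠ i → z ∈ p.support →
        ¬ Separates T i z x := by
      intro z x p hp hz hzp hs
      have h1 := hs (p.dropUntil z hzp)
      have h2 := hp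
      rw [← p.take_spec hzp, Walk.isPath_def, Walk.support_append] at h2
      have h3 : i ∈ (p.dropUntil z hzp).support.tail := by
        rw [← Walk.cons_tail_support, List.mem_cons] at h1
        exact h1.resolve_left hz.symm
      exact (List.nodup_append.1 h2).2.2 i (by simp) i h3 rfl
    intro z hz hzp hzq
    exact not_separates_trans (fun hs => aux hp hz hzp hs.symm) (aux hq hz hzq) h
  intro e he he'
  induction e with
  | h x y =>
    have hadj := p.adj_of_mem_edges he
    by_cases hx : x = i
    · refine key y (fun hy => hadj.ne (hx.trans hy.symm)) (p.snd_mem_support_of_mem_edges he)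
        (q.snd_mem_support_of_mem_edges he')
    · exact key x hx (p.fst_mem_support_of_mem_edges he) (q.fst_mem_support_of_mem_edges he')

/-- Separation replaces disjoint paths because its negation is transitive. Distinctness of the three
nodes is automatic, as a node outside `L` separates no node of `L` from itself. -/
theorem isFork_iff (hT : T.IsTree) {L : Set V} {i : V} :
    IsFork T L i ↔ i ∉ L ∧ ∃ a ∈ L, ∃ b ∈ L, ∃ c ∈ L,
      Separates T i a b ∧ Separates T i a c ∧ Separates T i b c := by
  constructor
  · rintro ⟨hi, a, b, c, ha, hb, hc, -, -, -, p, q, r, hp, hq, hr, h1, h2, h3⟩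
    have ne : ∀ x ∈ L, i ≠ x := fun x hx h => hi (h ▸ hx)
    exact ⟨hi, a, ha, b, hb, c, hc,
      separates_of_edges_disjoint hT.isAcyclic (ne a ha) (ne b hb) hp hq h1,
      separates_of_edges_disjoint hT.isAcyclic (ne a ha) (ne c hc) hp hr h2,
      separates_of_edges_disjoint hT.isAcyclic (ne b hb) (ne c hc) hq hr h3⟩
  · rintro ⟨hi, a, ha, b, hb, c, hc, h1, h2, h3⟩
    have ne : ∀ x ∈ L, i ≠ x := fun x hx h => hi (h ▸ hx)
    have ne' : ∀ x ∈ L, ∀ y, Separates T i x y → x ≠ y := by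
      rintro x hx _ h rfl
      exact not_separates_self (ne x hx) h
    obtain ⟨p, hp⟩ := hT.connected.exists_isPath i a
    obtain ⟨q, hq⟩ := hT.connected.exists_isPath i b
    obtain ⟨r, hr⟩ := hT.connected.exists_isPath i c
    exact ⟨hi, a, b, c, ha, hb, hc, ne' a ha b h1, ne' a ha c h2, ne' b hb c h3, p, q, r,
      hp, hq, hr, edges_disjoint_of_separates h1 hp hq, edges_disjoint_of_separates h2 hp hr,
      edges_disjoint_of_separates h3 hq hr⟩

/-- Of two nodes, at most one cuts a third node off from the other one. -/
theorem not_separates_of_separates (hT : T.Connected) {i j w : V} (hij : i ≠ j)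
    (h : Separates T i w j) : ¬ Separates T j w i := by
  classical
  intro h'
  obtain ⟨p, hp⟩ := hT.exists_isPath w i
  have hj := h' p
  have hi := h (p.takeUntil j hj)
  exact Walk.endpoint_notMem_support_takeUntil hp hj hij hi

/-- Adding one node to a set generates at most one new fork node. -/
theorem isFork_insert_unique (hT : T.IsTree) {L : Set V} {l i j : V}
    (hi : IsFork T (insert l L) i) (hi' : ¬ IsFork T L i)
    (hj : IsFork T (insert l L) j) (hj' : ¬ IsFork T L j) : i = j := by
  -- A new fork needs `l` as one of its three ends. Any `x ∈ L` on the side of `l` could replace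
  -- `l`, making `i` an old fork.
  have hsplit : ∀ {i : V}, IsFork T (insert l L) i → ¬ IsFork T L i →
      ∃ a ∈ L, ∃ b ∈ L, Separates T i a b ∧ ∀ x ∈ L, Separates T i x l := by
    intro i hi hi'
    rw [isFork_iff hT] at hi hi'
    obtain ⟨hiL, a, ha, b, hb, c, hc, h1, h2, h3⟩ := hi
    rw [Set.mem_insert_iff, not_or] at hiL
    have hself := not_separates_self (T := T) hiL.1
    have key : ∀ a ∈ L, ∀ b ∈ L, Separates T i a b → Separates T i a l → Separates T i b l →
        ∃ a ∈ L, ∃ b ∈ L, Separates T i a b ∧ ∀ x ∈ L, Separates T i x l := by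
      intro a ha b hb hab hal hbl
      refine ⟨a, ha, b, hb, hab, fun x hx => ?_⟩
      by_contra hxl
      refine hi' ⟨hiL.2, a, ha, b, hb, x, hx, hab, ?_, ?_⟩ <;> by_contra h
      · exact not_separates_trans h hxl hal
      · exact not_separates_trans h hxl hbl
    rcases ha with rfl | ha
    · rcases hb with rfl | hb
      · exact absurd h1 hself
      · rcases hc with rfl | hc
        · exact absurd h2 hself
        · exact key b hb c hc h3 h1.symm h2.symm
    · rcases hb with rfl | hb
      · rcases hc with rfl | hc
        · exact absurd h3 hself
        · exact key a ha c hc h2 h1 h3.symm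
      · rcases hc with rfl | hc
        · exact key a ha b hb h1 h2 h3
        · exact absurd ⟨hiL.2, a, ha, b, hb, c, hc, h1, h2, h3⟩ hi'
  by_contra hij
  -- Some `x ∈ L` lies behind `i` as seen from `j`, so `x` reaches `i` without `j`; as `j` cuts `x`
  -- from `l`, it cuts `i` from `l`. By symmetry `i` cuts `j` from `l`, which is impossible for both
  -- at once.
  have hl : ∀ {i j : V}, i ≠ j → (∃ a ∈ L, ∃ b ∈ L, Separates T i a b) →
      (∀ x ∈ L, Separates T j x l) → Separates T j l i := by
    rintro i j hij ⟨a, ha, b, hb, hab⟩ hx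
    have : ∃ x ∈ L, Separates T i x j := by
      by_contra! h
      exact not_separates_trans (h a ha) (fun hs => h b hb hs.symm) hab
    obtain ⟨x, hxL, hxs⟩ := this
    by_contra h
    exact not_separates_trans (not_separates_of_separates hT.connected hij hxs)
      (fun hs => h hs.symm) (hx x hxL)
  obtain ⟨a, ha, b, hb, hab, h⟩ := hsplit hi hi'
  obtain ⟨a', ha', b', hb', hab', h'⟩ := hsplit hj hj'
  exact not_separates_of_separates hT.connected (Ne.symm hij)
    (hl hij ⟨a, ha, b, hb, hab⟩ h') (hl (Ne.symm hij) ⟨a', ha', b', hb', hab'⟩ h)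

theorem plus_empty : plus T ∅ = ∅ := by
  ext i
  simp [plus, IsFork]

theorem subset_plus {L : Set V} : L ⊆ plus T L := Set.subset_union_left

theorem exists_separates_of_mem_plus (hT : T.IsTree) {L : Set V} {c : V} (hc : c ∈ plus T L)
    (x : V) : ∃ l ∈ L, Separates T c l x := by
  rcases hc with hcL | hcF
  · exact ⟨c, hcL, fun p => p.start_mem_support⟩
  · obtain ⟨-, a, haL, b, hbL, -, -, hab, -⟩ := (isFork_iff hT).1 hcF
    by_contra! h
    exact not_separates_trans (h a haL) (fun hs => h b hbL hs.symm) hab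

/-- Needed because `IsHingeTree` closes its query set under forks, and here that set is already
closed. Each end of a fork in `L⁺` can be replaced by a node of `L` on the same side of `i`. -/
theorem plus_plus (hT : T.IsTree) (L : Set V) : plus T (plus T L) = plus T L := by
  refine Set.Subset.antisymm ?_ subset_plus
  rintro i (hi | hi)
  · exact hi
  · obtain ⟨hiL, a, ha, b, hb, c, hc, hab, hac, hbc⟩ := (isFork_iff hT).1 hi
    have key : ∀ x ∈ plus T L, ∃ l ∈ L, ¬ Separates T i l x := by
      intro x hx
      obtain ⟨l, hl, hs⟩ := exists_separates_of_mem_plus hT hx i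
      exact ⟨l, hl, not_separates_of_separates hT.connected (fun h => hiL (h ▸ hx)) hs⟩
    have lift : ∀ {x y l m : V}, ¬ Separates T i l x → ¬ Separates T i m y →
        Separates T i x y → Separates T i l m := by
      intro x y l m hl hm hxy
      by_contra h
      exact not_separates_trans (not_separates_trans (fun hs => hl hs.symm) h) hm hxy
    obtain ⟨l, hl, hla⟩ := key a ha
    obtain ⟨m, hm, hmb⟩ := key b hb
    obtain ⟨n, hn, hnc⟩ := key c hc
    exact Or.inr ((isFork_iff hT).2 ⟨fun h => hiL (subset_plus h), l, hl, m, hm, n, hn,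
      lift hla hmb hab, lift hla hnc hac, lift hmb hnc hbc⟩)

theorem ncard_plus_le [Finite V] (hT : T.IsTree) (L : Set V) :
    (plus T L).ncard ≤ 2 * L.ncard := by
  induction L, L.toFinite using Set.Finite.induction_on with
  | empty => simp [plus_empty]
  | @insert l L hl _ ih =>
    have hnew : ({i | IsFork T (insert l L) i ∧ ¬ IsFork T L i} : Set V).ncard ≤ 1 :=
      (Set.ncard_le_one_iff).2 fun hi hj => isFork_insert_unique hT hi.1 hi.2 hj.1 hj.2
    have hsub : plus T (insert l L) ⊆
        insert l (plus T L ∪ {i | IsFork T (insert l L) i ∧ ¬ IsFork T L i}) := by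
      rintro i ((rfl | hi) | hi)
      · exact Set.mem_insert _ _
      · exact Or.inr (Or.inl (Or.inl hi))
      · by_cases h : IsFork T L i
        · exact Or.inr (Or.inl (Or.inr h))
        · exact Or.inr (Or.inr ⟨hi, h⟩)
    have h1 := Set.ncard_le_ncard hsub
    have h2 := Set.ncard_insert_le l
      (plus T L ∪ {i | IsFork T (insert l L) i ∧ ¬ IsFork T L i})
    have h3 := Set.ncard_union_le (plus T L) {i | IsFork T (insert l L) i ∧ ¬ IsFork T L i}
    rw [Set.ncard_insert_of_notMem hl]
    omega


/-! ### Components, hinge-trees and their leaving edges -/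

/-- The edges leaving the set `R`. -/
def boundary (T : SimpleGraph V) (R : Set V) : Set (Sym2 V) :=
  {e | ∃ u v : V, e = s(u, v) ∧ T.Adj u v ∧ u ∈ R ∧ v ∉ R}

/-- `C` is connected in the sense that walks inside `C` join its nodes. -/
def WalkConnected (T : SimpleGraph V) (C : Set V) : Prop :=
  ∀ u ∈ C, ∀ w ∈ C, ∃ p : T.Walk u w, ∀ z ∈ p.support, z ∈ C

theorem support_subset_of_closed {C : Set V} {u w : V} (p : T.Walk u w) (hu : u ∈ C)
    (h : ∀ x ∈ C, ∀ y ∈ p.support, T.Adj x y → y ∈ C) : ∀ z ∈ p.support, z ∈ C := by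
  induction p with
  | nil => simpa using hu
  | @cons u v w hadj p ih =>
    intro z hz
    rw [Walk.support_cons, List.mem_cons] at hz
    rcases hz with rfl | hz
    · exact hu
    · refine ih (h u hu v (by simp) hadj) (fun x hx y hy => h x hx y ?_) z hz
      rw [Walk.support_cons]
      exact List.mem_cons_of_mem _ hy

theorem exists_walk_of_induce {S : Set V} {x y : S} (p : (T.induce S).Walk x y) :
    ∃ q : T.Walk x.1 y.1, q.support = p.support.map Subtype.val := by
  induction p with
  | nil => exact ⟨Walk.nil, by simp⟩
  | cons h p ih =>
    obtain ⟨q, hq⟩ := ih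
    exact ⟨Walk.cons (by simpa using h) q, by simp [hq]⟩

theorem isComponent_iff {S C : Set V} :
    IsComponent T S C ↔ C.Nonempty ∧ C ⊆ Sᶜ ∧ WalkConnected T C ∧
      ∀ u ∈ C, ∀ w ∉ S, T.Adj u w → w ∈ C := by
  classical
  constructor
  · rintro ⟨c, rfl⟩
    refine ⟨?_, ?_, ?_, ?_⟩
    · exact c.nonempty_supp.image _
    · rintro _ ⟨x, -, rfl⟩
      exact x.2
    · rintro _ ⟨x, hx, rfl⟩ _ ⟨y, hy, rfl⟩
      rw [ConnectedComponent.mem_supp_iff] at hx hy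
      obtain ⟨p⟩ := ConnectedComponent.exact (hx.trans hy.symm)
      obtain ⟨q, hq⟩ := exists_walk_of_induce p
      refine ⟨q, fun z hz => ?_⟩
      rw [hq, List.mem_map] at hz
      obtain ⟨z, hz, rfl⟩ := hz
      refine ⟨z, ?_, rfl⟩
      rw [ConnectedComponent.mem_supp_iff, ← hx]
      exact ConnectedComponent.sound ⟨(p.takeUntil z hz).reverse⟩
    · rintro _ ⟨x, hx, rfl⟩ w hw hadj
      refine ⟨⟨w, hw⟩, ?_, rfl⟩
      rw [ConnectedComponent.mem_supp_iff] at hx ⊢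
      rw [← hx]
      exact ConnectedComponent.sound (Adj.reachable (by simpa using hadj.symm))
  · rintro ⟨⟨x, hx⟩, hCS, hconn, hcl⟩
    refine ⟨(T.induce Sᶜ).connectedComponentMk ⟨x, hCS hx⟩, ?_⟩
    ext v
    constructor
    · intro hv
      obtain ⟨p, hp⟩ := hconn v hv x hx
      refine ⟨⟨v, hCS hv⟩, ?_, rfl⟩
      rw [ConnectedComponent.mem_supp_iff]
      exact ConnectedComponent.sound ⟨p.induce Sᶜ fun z hz => hCS (hp z hz)⟩
    · rintro ⟨v, hv, rfl⟩
      rw [ConnectedComponent.mem_supp_iff] at hv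
      obtain ⟨p⟩ := ConnectedComponent.exact hv.symm
      obtain ⟨q, hq⟩ := exists_walk_of_induce p
      refine support_subset_of_closed q hx (fun a ha y hy hadj => hcl a ha y ?_ hadj) _
        q.end_mem_support
      rw [hq, List.mem_map] at hy
      obtain ⟨y, -, rfl⟩ := hy
      exact y.2

theorem exists_isComponent {S : Set V} {x : V} (hx : x ∉ S) :
    ∃ C, IsComponent T S C ∧ x ∈ C :=
  ⟨_, ⟨(T.induce Sᶜ).connectedComponentMk ⟨x, hx⟩, rfl⟩, ⟨x, hx⟩, rfl, rfl⟩

namespace IsComponent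

theorem nonempty {S C : Set V} (h : IsComponent T S C) : C.Nonempty := (isComponent_iff.1 h).1

theorem notMem {S C : Set V} (h : IsComponent T S C) {x : V} (hx : x ∈ C) : x ∉ S :=
  (isComponent_iff.1 h).2.1 hx

theorem walkConnected {S C : Set V} (h : IsComponent T S C) : WalkConnected T C :=
  (isComponent_iff.1 h).2.2.1

theorem mem_of_adj {S C : Set V} (h : IsComponent T S C) {u w : V} (hu : u ∈ C) (hw : w ∉ S)
    (hadj : T.Adj u w) : w ∈ C :=
  (isComponent_iff.1 h).2.2.2 u hu w hw hadj

theorem subset_of_walkConnected {S C D : Set V} (h : IsComponent T S C) (hD : WalkConnected T D)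
    (hDS : ∀ x ∈ D, x ∉ S) {x : V} (hxC : x ∈ C) (hxD : x ∈ D) : D ⊆ C := by
  intro y hy
  obtain ⟨p, hp⟩ := hD x hxD y hy
  exact support_subset_of_closed p hxC (fun a ha b hb hab => h.mem_of_adj ha (hDS b (hp b hb)) hab)
    y p.end_mem_support

theorem eq_of_mem {S C D : Set V} (hC : IsComponent T S C) (hD : IsComponent T S D) {x : V}
    (hxC : x ∈ C) (hxD : x ∈ D) : C = D :=
  Set.Subset.antisymm (hD.subset_of_walkConnected hC.walkConnected (fun _ => hC.notMem) hxD hxC)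
    (hC.subset_of_walkConnected hD.walkConnected (fun _ => hD.notMem) hxC hxD)

/-- A component for a larger removed set lies in a component for the smaller one. -/
theorem exists_superset {S S' D : Set V} (hSS : S ⊆ S') (hD : IsComponent T S' D) :
    ∃ C, IsComponent T S C ∧ D ⊆ C := by
  obtain ⟨x, hx⟩ := hD.nonempty
  obtain ⟨C, hC, hxC⟩ := exists_isComponent (T := T) (fun h => hD.notMem hx (hSS h))
  exact ⟨C, hC, hC.subset_of_walkConnected hD.walkConnected
    (fun y hy h => hD.notMem hy (hSS h)) hxC hx⟩

end IsComponent

/-- In a tree, two edges leaving a connected set `C` whose outer ends are joined outside of `C`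
are equal. -/
theorem eq_of_walk_outside (hT : T.IsAcyclic) {C : Set V} (hC : WalkConnected T C)
    {x y c d : V} (hx : x ∈ C) (hy : y ∈ C) (hxc : T.Adj x c) (hyd : T.Adj y d)
    (p : T.Walk c d) (hp : ∀ z ∈ p.support, z ∉ C) : x = y ∧ c = d := by
  classical
  obtain ⟨q, hq⟩ := hC x hx y hy
  have hqC : ∀ z ∈ q.bypass.support, z ∈ C := fun z hz =>
    hq z (q.support_bypass_subset_support hz)
  have hcC : c ∉ C := hp c p.start_mem_support
  have hdC : d ∉ C := hp d p.end_mem_support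
  have h1 : (Walk.cons hxc.symm q.bypass).IsPath :=
    (Walk.cons_isPath_iff _ _).2 ⟨q.bypass_isPath, fun h => hcC (hqC c h)⟩
  -- Otherwise `c`, `x`, …, `y`, `d` is the unique path from `c` to `d`, and `p` would have to visit
  -- `x ∈ C`.
  have hcd : c = d := by
    by_contra hcd
    have h2 : ((Walk.cons hxc.symm q.bypass).append (Walk.cons hyd Walk.nil)).IsPath := by
      refine isPath_append h1 ((Walk.cons_isPath_iff _ _).2 ⟨Walk.IsPath.nil, ?_⟩) ?_
      · simpa using hyd.ne
      · intro z hz hz'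
        simp only [Walk.support_cons, List.mem_cons, Walk.support_nil, List.not_mem_nil,
          or_false] at hz hz'
        rcases hz' with h | rfl
        · exact h
        · rcases hz with h | hz
          · exact absurd h.symm hcd
          · exact absurd (hqC _ hz) hdC
    exact hp x (separates_of_isPath (i := x) hT h2 (by simp) p) hx
  subst hcd
  refine ⟨?_, rfl⟩
  have hmem := separates_of_isPath (i := x) hT h1 (by simp) (Walk.cons hyd.symm Walk.nil)
  rw [Walk.support_cons, Walk.support_nil, List.mem_cons, List.mem_singleton] at hmem
  exact hmem.resolve_left hxc.ne

/-- A component left over by `L⁺` has at most two edges leaving it. -/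
theorem ncard_boundary_le_two [Finite V] (hT : T.IsTree) {L C : Set V}
    (hC : IsComponent T (plus T L) C) :
    (boundary T C).ncard ≤ 2 := by
  classical
  by_contra hlt
  rw [not_le, Set.two_lt_ncard_iff] at hlt
  obtain ⟨_, _, _, ⟨x₁, c₁, rfl, ha₁, hx₁, hc₁⟩, ⟨x₂, c₂, rfl, ha₂, hx₂, hc₂⟩,
    ⟨x₃, c₃, rfl, ha₃, hx₃, hc₃⟩, h12, h13, h23⟩ := hlt
  -- Behind each leaving edge there is a node of `L` that reaches the outer end without entering
  -- `C`.
  have outer : ∀ {x c : V}, T.Adj x c → x ∈ C → c ∉ C →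
      ∃ l ∈ L, ∃ p : T.Walk l c, ∀ z ∈ p.support, z ∉ C := by
    intro x c ha hx hc
    have hcQ : c ∈ plus T L := by
      by_contra h
      exact hc (hC.mem_of_adj hx h ha)
    obtain ⟨l, hlL, hl⟩ := exists_separates_of_mem_plus hT hcQ x
    obtain ⟨p, hp⟩ := hT.connected.exists_isPath l c
    refine ⟨l, hlL, p, fun z hz hzC => ?_⟩
    obtain ⟨q, hq⟩ := hC.walkConnected z hzC x hx
    have hmem := hl ((p.takeUntil z hz).append q)
    rw [Walk.mem_support_append_iff] at hmem
    rcases hmem with h | h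
    · exact Walk.endpoint_notMem_support_takeUntil hp hz (fun h => hc (h ▸ hzC)) h
    · exact hc (hq c h)
  obtain ⟨l₁, hl₁, p₁, hp₁⟩ := outer ha₁ hx₁ hc₁
  obtain ⟨l₂, hl₂, p₂, hp₂⟩ := outer ha₂ hx₂ hc₂
  obtain ⟨l₃, hl₃, p₃, hp₃⟩ := outer ha₃ hx₃ hc₃
  have disj : ∀ {x y c d l m i : V} (p : T.Walk l c) (q : T.Walk m d), T.Adj x c → T.Adj y d →
      x ∈ C → y ∈ C → (∀ z ∈ p.support, z ∉ C) → (∀ z ∈ q.support, z ∉ C) →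
      s(x, c) ≠ s(y, d) → i ∈ p.support → i ∉ q.support := by
    intro x y c d l m i p q hxc hyd hx hy hp hq hne hip hiq
    obtain ⟨rfl, rfl⟩ := eq_of_walk_outside hT.isAcyclic hC.walkConnected hx hy hxc hyd
      ((p.dropUntil i hip).reverse.append (q.dropUntil i hiq)) (by
        intro z hz
        rw [Walk.mem_support_append_iff, Walk.support_reverse, List.mem_reverse] at hz
        rcases hz with hz | hz
        · exact hp z (p.support_dropUntil_subset_support hip hz)
        · exact hq z (q.support_dropUntil_subset_support hiq hz))
    exact hne rfl
  have thru : ∀ {x y c d l m i : V} (p : T.Walk l c) (q : T.Walk m d), T.Adj x c → T.Adj y d →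
      x ∈ C → y ∈ C → i ∉ C → Separates T i l m → i ∈ p.support ∨ i ∈ q.support := by
    intro x y c d l m i p q hxc hyd hx hy hi hs
    obtain ⟨r, hr⟩ := hC.walkConnected x hx y hy
    have := hs (p.append (Walk.cons hxc.symm (r.append (Walk.cons hyd q.reverse))))
    simp only [Walk.mem_support_append_iff, Walk.support_cons, List.mem_cons,
      Walk.support_reverse, List.mem_reverse] at this
    rcases this with h | h | h | h | h
    · exact Or.inl h
    · exact Or.inl (h ▸ p.end_mem_support)
    · exact absurd (hr i h) hi
    · exact absurd (h ▸ hy) hi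
    · exact Or.inr h
  -- A median inside `C` would be a fork. Outside `C` it would lie on two of the three outer walks,
  -- which are pairwise disjoint.
  obtain ⟨i, hi12, hi13, hi23⟩ := exists_median hT l₁ l₂ l₃
  by_cases hi : i ∈ C
  · have hiQ : i ∉ plus T L := hC.notMem hi
    refine hiQ (Or.inr ((isFork_iff hT).2 ⟨fun h => hiQ (subset_plus h), l₁, hl₁, l₂, hl₂, l₃, hl₃,
      hi12, hi13, hi23⟩))
  · have t12 := thru p₁ p₂ ha₁ ha₂ hx₁ hx₂ hi hi12
    have t13 := thru p₁ p₃ ha₁ ha₃ hx₁ hx₃ hi hi13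
    have t23 := thru p₂ p₃ ha₂ ha₃ hx₂ hx₃ hi hi23
    have d12 := disj (i := i) p₁ p₂ ha₁ ha₂ hx₁ hx₂ hp₁ hp₂ h12
    have d13 := disj (i := i) p₁ p₃ ha₁ ha₃ hx₁ hx₃ hp₁ hp₃ h13
    have d23 := disj (i := i) p₂ p₃ ha₂ ha₃ hx₂ hx₃ hp₂ hp₃ h23
    tauto

theorem exists_boundary_of_walk {C : Set V} {u w : V} (p : T.Walk u w) (hu : u ∈ C)
    (hw : w ∉ C) : ∃ x y, T.Adj x y ∧ x ∈ C ∧ y ∉ C := by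
  obtain ⟨d, -, hd, hd'⟩ := p.exists_boundary_dart C hu hw
  exact ⟨d.fst, d.snd, d.adj, hd, hd'⟩

theorem one_le_ncard_boundary [Finite V] (hT : T.Connected) {C : Set V} (hC : C.Nonempty)
    (hC' : ∃ w, w ∉ C) : 1 ≤ (boundary T C).ncard := by
  obtain ⟨u, hu⟩ := hC
  obtain ⟨w, hw⟩ := hC'
  obtain ⟨p⟩ := hT.preconnected u w
  obtain ⟨x, y, hxy, hx, hy⟩ := exists_boundary_of_walk p hu hw
  exact (Set.ncard_pos).2 ⟨_, x, y, rfl, hxy, hx, hy⟩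

/-- A hinge-tree has one or two connection nodes. -/
theorem connNodes_cases [Finite V] (hT : T.IsTree) {L C : Set V} (hC : IsComponent T (plus T L) C)
    (hL : (plus T L).Nonempty) :
    (∃ c, connNodes T (plus T L) C = {c}) ∨
      ∃ c c', c ≠ c' ∧ connNodes T (plus T L) C = {c, c'} := by
  have hpos : 0 < (connNodes T (plus T L) C).ncard := by
    obtain ⟨w, hw⟩ := hL
    obtain ⟨u, hu⟩ := hC.nonempty
    obtain ⟨p⟩ := hT.connected.preconnected u w
    obtain ⟨x, y, hxy, hx, hy⟩ := exists_boundary_of_walk p hu (fun h => hC.notMem h hw)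
    refine (Set.ncard_pos).2 ⟨y, ?_, x, hx, hxy.symm⟩
    by_contra h
    exact hy (hC.mem_of_adj hx h hxy)
  have hle : (connNodes T (plus T L) C).ncard ≤ 2 := by
    refine le_trans ?_ (ncard_boundary_le_two hT hC)
    choose! f hf using fun c (hc : c ∈ connNodes T (plus T L) C) => hc.2
    refine Set.ncard_le_ncard_of_injOn (fun c => s(f c, c)) ?_ ?_
    · intro c hc
      exact ⟨f c, c, rfl, (hf c hc).2.symm, (hf c hc).1, fun h => hC.notMem h hc.1⟩
    · intro c hc d hd hcd
      simp only [Sym2.eq_iff] at hcd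
      rcases hcd with h | h
      · exact h.2
      · exact absurd hd.1 (hC.notMem (h.1 ▸ (hf c hc).1))
  rcases Nat.lt_or_ge (connNodes T (plus T L) C).ncard 2 with h | h
  · exact Or.inl (Set.ncard_eq_one.1 (by omega))
  · obtain ⟨c, c', h1, h2⟩ := Set.ncard_eq_two.1 (le_antisymm hle h)
    exact Or.inr ⟨c, c', h1, h2⟩

/-- A hinge-tree on which the mincut predictor errs touches an edge of the cut. -/
theorem exists_cut_of_error [Finite V] (hT : T.IsTree) {L C : Set V}
    {A : Predictor (plus T L)} (hA : IsPred T (plus T L) A) (hL : (plus T L).Nonempty)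
    (hC : IsHingeTree T (plus T L) C) {y : V → Bool} {i : V} (hi : i ∈ C)
    (herr : A ((plus T L).domRestrict y) i ≠ y i) :
    ∃ u v, T.Adj u v ∧ y u ≠ y v ∧ u ∈ C := by
  have hC' : IsComponent T (plus T L) C := by rwa [IsHingeTree, plus_plus hT] at hC
  by_contra! h
  have hconst : ∀ j ∈ C, y j = y i := by
    intro j hj
    obtain ⟨p, hp⟩ := hC'.walkConnected i hi j hj
    have := support_subset_of_closed (C := {z | z ∈ C ∧ y z = y i}) p ⟨hi, rfl⟩
      (fun a ha b hb hab => ⟨hp b hb, by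
        rw [← ha.2]; by_contra hne; exact h a b hab (fun h => hne h.symm) ha.1⟩) j
      p.end_mem_support
    exact this.2
  have hconn : ∀ c ∈ connNodes T (plus T L) C, y c = y i := by
    rintro c ⟨-, j, hj, hcj⟩
    rw [← hconst j hj]
    by_contra hne
    exact h j c hcj.symm (fun h => hne h.symm) hj
  obtain ⟨h1, h2, -⟩ := hA y C hC
  rcases connNodes_cases hT hC' hL with ⟨c, hc⟩ | ⟨c, c', hne, hc⟩
  · exact herr ((h1 c hc i hi).trans (hconn c (by simp [hc])))
  · have e1 := hconn c (by simp [hc])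
    have e2 := hconn c' (by simp [hc])
    exact herr ((h2 c c' hne hc (e1.trans e2.symm) i hi).trans e1)


/-! ### The adversary: regions forcing mistakes -/

/-- In a tree, every set of edges is the cut of some labeling. -/
theorem exists_labeling_of_cut (hT : T.IsTree) (F : Set (Sym2 V)) :
    ∃ b : V → Bool, ∀ u v, T.Adj u v → (b u ≠ b v ↔ s(u, v) ∈ F) := by
  classical
  obtain ⟨r⟩ := hT.connected.nonempty
  choose p hp using fun v => hT.connected.exists_isPath r v
  -- The label is the parity of the number of edges of `F` on the path from the root.
  let b : V → Bool := fun v => decide (Odd ((p v).edges.countP (· ∈ F)))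
  have uniq : ∀ {v : V} (q : T.Walk r v), q.IsPath → q = p v := fun q hq =>
    congrArg Subtype.val ((hT.isAcyclic.subsingleton_path _ _).elim ⟨q, hq⟩ ⟨_, hp _⟩)
  have key : ∀ u v, T.Adj u v → v ∉ (p u).support → (b u ≠ b v ↔ s(u, v) ∈ F) := by
    intro u v huv hv
    have h := uniq ((p u).concat huv) ((hp u).concat hv huv)
    have hc : (p v).edges.countP (· ∈ F) =
        (p u).edges.countP (· ∈ F) + if s(u, v) ∈ F then 1 else 0 := by
      rw [← h, Walk.edges_concat, List.concat_eq_append, List.countP_append]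
      simp [List.countP_cons]
    simp only [b, hc]
    by_cases hF : s(u, v) ∈ F
    · simp only [hF, if_true, Nat.odd_add_one, ne_eq, decide_eq_decide, iff_true]
      tauto
    · simp [hF]
  refine ⟨b, fun u v huv => ?_⟩
  by_cases hv : v ∈ (p u).support
  · have h := uniq _ ((hp u).takeUntil hv)
    have hu : u ∉ (p v).support := by
      rw [← h]
      exact Walk.endpoint_notMem_support_takeUntil (hp u) hv huv.ne
    rw [ne_comm, Sym2.eq_swap]
    exact key v u huv.symm hu
  · exact key u v huv hv

theorem ncard_le_mistakes_add_mistakes [Finite V] {L R : Set V} (hRL : Disjoint R L)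
    (p y y' : V → Bool) (h : ∀ v ∈ R, y v ≠ y' v) :
    R.ncard ≤ mistakes L p y + mistakes L p y' := by
  refine le_trans (Set.ncard_le_ncard ?_) (Set.ncard_union_le _ _)
  intro v hv
  have hvL : v ∉ L := Set.disjoint_left.1 hRL hv
  by_cases hp : p v = y v
  · exact Or.inr ⟨hvL, fun h' => h v hv (hp.symm.trans h')⟩
  · exact Or.inl ⟨hvL, hp⟩

/-- Two labelings that agree on `L` and differ on `R` force `|R| / 2` mistakes on average. -/
theorem ncard_le_two_mul_lowerBound_of_labelings [Finite V] {K : ℕ} {L R : Set V}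
    (hRL : Disjoint R L) (y₀ y₁ : V → Bool) (h₀ : cutsize T y₀ ≤ K) (h₁ : cutsize T y₁ ≤ K)
    (hL : ∀ v ∈ L, y₀ v = y₁ v) (hR : ∀ v ∈ R, y₀ v ≠ y₁ v) :
    (R.ncard : ℝ≥0∞) ≤ 2 * lowerBound T L K := by
  classical
  let f : Bool → V → Bool := fun b => if b then y₁ else y₀
  let D : PMF (V → Bool) := (PMF.uniformOfFintype Bool).map f
  have hD : ∀ y ∈ D.support, cutsize T y ≤ K := by
    intro y hy
    rw [PMF.mem_support_map_iff] at hy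
    obtain ⟨b, -, rfl⟩ := hy
    cases b <;> simpa [f]
  have hsum : ∀ h : (V → Bool) → ℝ≥0∞, ∑' y, D y * h y = 2⁻¹ * h y₀ + 2⁻¹ * h y₁ := by
    intro h
    have : ∀ y, D y * h y = ∑' b : Bool, if y = f b then 2⁻¹ * h (f b) else 0 := by
      intro y
      rw [PMF.map_apply, ← ENNReal.tsum_mul_right]
      refine tsum_congr fun b => ?_
      split_ifs with hy
      · simp [hy, PMF.uniformOfFintype_apply]
      · simp
    simp_rw [this]
    rw [ENNReal.tsum_comm]
    simp [tsum_ite_eq, f, add_comm]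
  have hL' : L.domRestrict y₀ = L.domRestrict y₁ := by
    funext v
    exact hL v v.2
  -- The predictor sees the same labels in both cases, so its output has one distribution, and each
  -- output errs on every node of `R` for one of the two labelings.
  have hA : ∀ A : RandPredictor L, (R.ncard : ℝ≥0∞) / 2 ≤ expMistakes L A D := by
    intro A
    rw [expMistakes, hsum, ← hL', ← mul_add, ← ENNReal.tsum_add, ENNReal.div_eq_inv_mul]
    gcongr
    calc (R.ncard : ℝ≥0∞) = ∑' p, A (L.domRestrict y₀) p * (R.ncard : ℝ≥0∞) := by
          rw [ENNReal.tsum_mul_right, PMF.tsum_coe, one_mul]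
      _ ≤ _ := by
          refine ENNReal.tsum_le_tsum fun p => ?_
          rw [← mul_add]
          gcongr
          exact_mod_cast ncard_le_mistakes_add_mistakes hRL p y₀ y₁ hR
  have hle : (R.ncard : ℝ≥0∞) / 2 ≤ lowerBound T L K :=
    le_iSup₂_of_le D hD (le_iInf hA)
  rwa [ENNReal.div_le_iff_le_mul (by simp) (by simp), mul_comm] at hle

/-- A set that avoids `L` and has at most `2K` leaving edges forces half of its size in
mistakes. -/
theorem ncard_le_two_mul_lowerBound [Finite V] (hT : T.IsTree) {K : ℕ} {L R : Set V}
    (hRL : Disjoint R L) (hR : (boundary T R).ncard ≤ 2 * K) :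
    (R.ncard : ℝ≥0∞) ≤ 2 * lowerBound T L K := by
  classical
  -- Flipping the labels on `R` toggles exactly the leaving edges, so the two cuts lie in `F` and in
  -- its complement in the boundary.
  obtain ⟨F, hFR, hF⟩ := Set.exists_subset_card_eq (s := boundary T R)
    (n := min K (boundary T R).ncard) (min_le_right _ _)
  obtain ⟨b, hb⟩ := exists_labeling_of_cut hT F
  have hdiff := Set.ncard_sdiff_add_ncard_of_subset hFR
  have hbd : ∀ {i j : V}, T.Adj i j → (s(i, j) ∈ boundary T R ↔ ¬ (i ∈ R ↔ j ∈ R)) := by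
    intro i j hij
    constructor
    · rintro ⟨u, v, he, -, hu, hv⟩
      rw [Sym2.eq_iff] at he
      rcases he with ⟨rfl, rfl⟩ | ⟨rfl, rfl⟩ <;> tauto
    · intro h
      by_cases hi : i ∈ R
      · exact ⟨i, j, rfl, hij, hi, by tauto⟩
      · exact ⟨j, i, Sym2.eq_swap, hij.symm, by tauto, hi⟩
  refine ncard_le_two_mul_lowerBound_of_labelings hRL b (fun v => if v ∈ R then !b v else b v)
    (le_trans (Set.ncard_le_ncard (t := F) ?_) (hF.trans_le (min_le_left _ _)))
    (le_trans (Set.ncard_le_ncard (t := boundary T R \ F) ?_) (by omega)) ?_ ?_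
  · rintro _ ⟨i, j, rfl, hij, hne⟩
    exact (hb i j hij).1 hne
  · rintro _ ⟨i, j, rfl, hij, hne⟩
    have h1 := hb i j hij
    have h2 := hbd hij
    have h3 := @hFR s(i, j)
    rw [Set.mem_sdiff, h2, ← h1]
    rw [← h1, h2] at h3
    by_cases hi : i ∈ R <;> by_cases hj : j ∈ R <;> simp_all
  · intro v hv
    have : v ∉ R := Set.disjoint_right.1 hRL hv
    simp [this]
  · intro v hv
    simp [hv]


/-! ### The selection algorithm and its partition -/

theorem le_sigma [Finite V] {C D : Set V} {i : V} (hD : IsComponent T (Cᶜ ∪ {i}) D) :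
    D.ncard ≤ sigma T C i := by
  refine le_csSup ⟨Nat.card V, ?_⟩ ⟨D, hD, rfl⟩
  rintro _ ⟨D, -, rfl⟩
  rw [← Set.ncard_univ]
  exact Set.ncard_le_ncard (Set.subset_univ _)

/-- Positivity of `n` covers the case without components, where the supremum is `0`. -/
theorem sigma_lt {C : Set V} {i : V} {n : ℕ} (hn : 0 < n)
    (h : ∀ D, IsComponent T (Cᶜ ∪ {i}) D → D.ncard < n) : sigma T C i < n := by
  rw [sigma]
  rcases Set.eq_empty_or_nonempty {m | ∃ D : Set V, IsComponent T (Cᶜ ∪ {i}) D ∧ m = D.ncard}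
    with h' | h'
  · rw [h']
    simpa using hn
  · by_cases hb : BddAbove {m | ∃ D : Set V, IsComponent T (Cᶜ ∪ {i}) D ∧ m = D.ncard}
    · obtain ⟨D, hD, he⟩ := Nat.sSup_mem h' hb
      exact he ▸ h D hD
    · exact absurd ⟨n, by rintro _ ⟨D, hD, rfl⟩; exact (h D hD).le⟩ hb

/-- Removing a node that minimizes `sigma` leaves components of at most half the size. -/
theorem two_mul_ncard_le_of_sigma_min [Finite V] (hT : T.IsAcyclic) {C D : Set V} {i : V}
    (hC : WalkConnected T C) (hi : i ∈ C) (hmin : ∀ j ∈ C, sigma T C i ≤ sigma T C j)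
    (hD : IsComponent T (Cᶜ ∪ {i}) D) : 2 * D.ncard ≤ C.ncard := by
  by_contra! hlt
  have hDi : i ∉ D := fun h => hD.notMem h (Or.inr rfl)
  have hDC : D ⊆ C := fun x hx => by
    by_contra h
    exact hD.notMem hx (Or.inl h)
  have exit : ∀ {u : V} (p : T.Walk u i), u ∈ D → (∀ z ∈ p.support, z ∈ C) →
      ∃ x ∈ p.support, x ∈ D ∧ T.Adj x i := by
    intro u p hu hp
    obtain ⟨d, hd, h1, h2⟩ := p.exists_boundary_dart D hu hDi
    have h3 := p.dart_fst_mem_support_of_mem_darts hd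
    have h4 := p.dart_snd_mem_support_of_mem_darts hd
    have : d.snd = i := by
      by_contra hne
      refine h2 (hD.mem_of_adj h1 ?_ d.adj)
      simp [hp _ h4, hne]
    exact ⟨d.fst, h3, h1, this ▸ d.adj⟩
  obtain ⟨u, hu⟩ := hD.nonempty
  obtain ⟨p, hp⟩ := hC u (hDC hu) i hi
  obtain ⟨j, -, hj, hji⟩ := exit p hu hp
  have hdiff := Set.ncard_sdiff_add_ncard_of_subset hDC
  have hpos : 0 < D.ncard := (Set.ncard_pos).2 hD.nonempty
  -- The neighbour `j` of `i` in `D` does better. A component of `C ∖ {j}` disjoint from `D` fits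
  -- into `C ∖ D`, which is smaller than `D`. One meeting `D` cannot reach `i`, as `j` is the only
  -- access from `D`, so it lies in `D` without `j`.
  refine absurd (hmin j (hDC hj)) (not_le.2 (lt_of_lt_of_le (sigma_lt hpos ?_) (le_sigma hD)))
  intro D' hD'
  have hDC' : D' ⊆ C := fun x hx => by
    by_contra h
    exact hD'.notMem hx (Or.inl h)
  have hj' : j ∉ D' := fun h => hD'.notMem h (Or.inr rfl)
  by_cases hdis : Disjoint D' D
  · have : D'.ncard ≤ (C \ D).ncard :=
      Set.ncard_le_ncard fun x hx => ⟨hDC' hx, Set.disjoint_left.1 hdis hx⟩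
    omega
  · obtain ⟨x, hx', hx⟩ := Set.not_disjoint_iff.1 hdis
    by_cases hi' : i ∈ D'
    · exfalso
      obtain ⟨q, hq⟩ := hD'.walkConnected x hx' i hi'
      obtain ⟨y, hy, hyD, hyi⟩ := exit q hx fun z hz => hDC' (hq z hz)
      have := (eq_of_walk_outside hT hD.walkConnected hyD hj hyi hji Walk.nil (by simpa)).1
      exact hj' (this ▸ hq y hy)
    · refine Set.ncard_lt_ncard ⟨hD.subset_of_walkConnected hD'.walkConnected ?_ hx hx', ?_⟩
      · rintro z hz (h | rfl)
        · exact h (hDC' hz)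
        · exact hi' hz
      · exact fun h => hj' (h hj)

theorem IsComponent.within {L C D : Set V} {i : V} (hC : IsComponent T L C)
    (hD : IsComponent T (insert i L) D) (hDC : D ⊆ C) : IsComponent T (Cᶜ ∪ {i}) D := by
  refine isComponent_iff.2 ⟨hD.nonempty, ?_, hD.walkConnected, ?_⟩
  · rintro x hx (h | rfl)
    · exact h (hDC hx)
    · exact hD.notMem hx (Set.mem_insert _ _)
  · intro u hu w hw hadj
    simp only [Set.mem_union, Set.mem_compl_iff, Set.mem_singleton_iff, not_or, not_not] at hw
    refine hD.mem_of_adj hu ?_ hadj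
    rintro (h | h)
    · exact hw.2 h
    · exact hC.notMem hw.1 h

/-- The edges of the tree joining different fibres of `g`. -/
def crossing (T : SimpleGraph V) (g : V → V) : Set (Sym2 V) :=
  {e | ∃ i j : V, e = s(i, j) ∧ T.Adj i j ∧ g i ≠ g j}

/-- The nodes assigned to `t` by `g`. -/
def fibre (g : V → V) (t : V) : Set V := {v | g v = t}

/-- The partition of the tree maintained along a run of the selection algorithm. The part of
`t ∈ L` consists of `t` and of those components left over by `t` in which nothing has been selected
since; `c t` is the number of the other components left over by `t`. -/
structure SelPartition [Fintype V] (T : SimpleGraph V) (L : Set V) (g : V → V) (c : V → ℕ) :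
    Prop where
  mem : ∀ v, g v ∈ L
  self : ∀ t ∈ L, g t = t
  adj : ∀ u v, u ∉ L → v ∉ L → T.Adj u v → g u = g v
  walk : ∀ x t, g x = t → ∃ p : T.Walk x t, ∀ z ∈ p.support, z ∈ L → z = t
  crossing : (crossing T g).ncard + 1 ≤ L.ncard
  zero : ∀ v ∉ L, c v = 0
  le : ∀ t ∈ L, c t ≤ {v | T.Adj t v ∧ g v ≠ t}.ncard
  sum : ∑ v, c v + 1 = L.ncard
  size_zero : ∀ t ∈ L, c t = 0 → ∀ D, IsComponent T L D → D.ncard ≤ (fibre g t).ncard ∧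
    (D ⊆ fibre g t → 2 * D.ncard ≤ (fibre g t).ncard)
  size_one : ∀ t ∈ L, c t = 1 → ∀ D, IsComponent T L D → D.ncard ≤ 2 * (fibre g t).ncard

namespace SelPartition
variable [Fintype V] {L C : Set V} {g : V → V} {c : V → ℕ}

theorem eq_of_mem (h : SelPartition T L g c) (hC : IsComponent T L C) {u v : V} (hu : u ∈ C)
    (hv : v ∈ C) : g u = g v := by
  obtain ⟨p, hp⟩ := hC.walkConnected v hv u hu
  exact (support_subset_of_closed (C := {z | z ∈ C ∧ g z = g v}) p ⟨hv, rfl⟩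
    (fun a ha b hb hab => ⟨hp b hb, by
      rw [← ha.2]
      exact (h.adj a b (hC.notMem ha.1) (hC.notMem (hp b hb)) hab).symm⟩) u p.end_mem_support).2

/-- A walk from `i` to `g i` can leave `C` only into `L`, and it meets no other node of `L`. -/
theorem exists_adj (h : SelPartition T L g c) (hC : IsComponent T L C) {i : V} (hi : i ∈ C) :
    ∃ x ∈ C, T.Adj x (g i) := by
  obtain ⟨p, hp⟩ := h.walk i _ rfl
  obtain ⟨d, hd, h1, h2⟩ := p.exists_boundary_dart C hi (fun hg => hC.notMem hg (h.mem i))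
  have h3 : d.snd ∈ L := by
    by_contra h3
    exact h2 (hC.mem_of_adj h1 h3 d.adj)
  exact ⟨d.fst, h1, hp _ (p.dart_snd_mem_support_of_mem_darts hd) h3 ▸ d.adj⟩

theorem start (hT : T.IsTree) {i : V} (hC : IsComponent T ∅ C) (hi : i ∈ C)
    (hmin : ∀ j ∈ C, sigma T C i ≤ sigma T C j) : SelPartition T {i} (fun _ => i) (fun _ => 0) := by
  have hCu : C = Set.univ := by
    refine Set.eq_univ_of_forall fun x => ?_
    obtain ⟨p⟩ := hT.connected.preconnected i x
    exact support_subset_of_closed p hi (fun a ha b _ hab => hC.mem_of_adj ha (by simp) hab) x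
      p.end_mem_support
  have hfib : fibre (fun _ : V => i) i = Set.univ := by
    ext; simp [fibre]
  refine ⟨by simp, by simp, by simp, ?_, ?_, by simp, by simp, by simp, ?_, by simp⟩
  · rintro x _ rfl
    obtain ⟨p⟩ := hT.connected.preconnected x i
    exact ⟨p, by simp⟩
  · have : TreeQuery.crossing T (fun _ => i) = ∅ := by
      ext; simp [TreeQuery.crossing]
    simp [this]
  · rintro t rfl - D hD
    rw [hfib]
    refine ⟨Set.ncard_le_ncard (Set.subset_univ _), fun _ => ?_⟩
    rw [← hCu]
    exact two_mul_ncard_le_of_sigma_min hT.isAcyclic hC.walkConnected hi hmin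
      (hC.within (by simpa using hD) (hCu ▸ Set.subset_univ _))

open Classical in
theorem step (hT : T.IsTree) (h : SelPartition T L g c) {i : V} (hC : IsComponent T L C)
    (hmax : ∀ C', IsComponent T L C' → C'.ncard ≤ C.ncard) (hi : i ∈ C)
    (hmin : ∀ j ∈ C, sigma T C i ≤ sigma T C j) :
    SelPartition T (insert i L) (fun v => if v ∈ C then i else g v)
      (Function.update c (g i) (c (g i) + 1)) := by
  have hiL : i ∉ L := hC.notMem hi
  have hne : ∀ s ∈ L, i ≠ s := fun s hs he => hiL (he ▸ hs)
  have hLC : ∀ s ∈ L, s ∉ C := fun s hs hsC => hC.notMem hsC hs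
  have hgC : ∀ v ∈ C, g v = g i := fun v hv => h.eq_of_mem hC hv hi
  have hcard := Set.ncard_insert_of_notMem hiL
  obtain ⟨x, hxC, hx⟩ := h.exists_adj hC hi
  have fib_self : fibre (fun v => if v ∈ C then i else g v) i = C := by
    ext v
    by_cases hv : v ∈ C
    · simp [fibre, hv]
    · simpa [fibre, hv] using (hne _ (h.mem v)).symm
  have fib_old : ∀ s ∈ L, s ≠ g i → fibre (fun v => if v ∈ C then i else g v) s = fibre g s := by
    intro s hs hsg
    ext v
    by_cases hv : v ∈ C
    · simp [fibre, hv, hne s hs, hgC v hv, hsg.symm]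
    · simp [fibre, hv]
  have fib_par : fibre (fun v => if v ∈ C then i else g v) (g i) = fibre g (g i) \ C := by
    ext v
    by_cases hv : v ∈ C
    · simp [fibre, hv, hne _ (h.mem i)]
    · simp [fibre, hv]
  have hsup : ∀ {D}, IsComponent T (insert i L) D → ∃ D₀, IsComponent T L D₀ ∧ D ⊆ D₀ :=
    fun hD => hD.exists_superset (Set.subset_insert _ _)
  refine ⟨?_, ?_, ?_, ?_, ?_, ?_, ?_, ?_, ?_, ?_⟩
  · intro v
    by_cases hv : v ∈ C
    · simp [hv]
    · simp [hv, h.mem v]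
  · rintro t (rfl | ht)
    · simp [hi]
    · simp [hLC t ht, h.self t ht]
  · intro u v hu hv huv
    rw [Set.mem_insert_iff, not_or] at hu hv
    by_cases huC : u ∈ C
    · simp [huC, hC.mem_of_adj huC hv.2 huv]
    · have hvC : v ∉ C := fun hvC => huC (hC.mem_of_adj hvC hu.2 huv.symm)
      simpa [huC, hvC] using h.adj u v hu.2 hv.2 huv
  · intro y t hyt
    by_cases hy : y ∈ C
    · simp only [hy, if_true] at hyt
      subst hyt
      obtain ⟨p, hp⟩ := hC.walkConnected y hy i hi
      exact ⟨p, fun z hz hzL => hzL.resolve_right (hC.notMem (hp z hz))⟩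
    · simp only [hy, if_false] at hyt
      obtain ⟨p, hp⟩ := h.walk y t hyt
      have ht : t ∈ L := hyt ▸ h.mem y
      have hsub : ∀ z ∈ p.bypass.support, z ∈ L → z = t := fun z hz =>
        hp z (p.support_bypass_subset_support hz)
      refine ⟨p.bypass, fun z hz hzL => ?_⟩
      rcases hzL with rfl | hzL
      · exfalso
        -- The path enters `C` from a node of `L`, which must be its end `t`; but a path cannot
        -- visit its end before `i`.
        obtain ⟨d, hd, h1, h2⟩ :=
          (p.bypass.takeUntil z hz).exists_boundary_dart Cᶜ hy (by simpa using hi)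
        rw [Set.mem_compl_iff, not_not] at h2
        have hdL : d.fst ∈ L := by
          by_contra hdL
          exact h1 (hC.mem_of_adj h2 hdL d.adj.symm)
        have h3 := (p.bypass.takeUntil z hz).dart_fst_mem_support_of_mem_darts hd
        have h4 := hsub _ (p.bypass.support_takeUntil_subset_support hz h3) hdL
        exact Walk.endpoint_notMem_support_takeUntil p.bypass_isPath hz (hne t ht).symm (h4 ▸ h3)
      · exact hsub z hz hzL
  -- Only one edge becomes crossing: the single edge between `C` and `g i`. Edges from `C` to other
  -- selected nodes were crossing already.
  · have hsub : TreeQuery.crossing T (fun v => if v ∈ C then i else g v) ⊆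
        insert s(g i, x) (TreeQuery.crossing T g) := by
      have key : ∀ u v, T.Adj u v → u ∈ C → v ∉ C →
          s(u, v) ∈ insert s(g i, x) (TreeQuery.crossing T g) := by
        intro u v huv hu hv
        have hvL : v ∈ L := by
          by_contra hvL
          exact hv (hC.mem_of_adj hu hvL huv)
        by_cases hvg : v = g i
        · subst hvg
          obtain ⟨rfl, -⟩ := eq_of_walk_outside hT.isAcyclic hC.walkConnected hu hxC huv hx
            Walk.nil (by simpa using hv)
          exact Or.inl Sym2.eq_swap
        · exact Or.inr ⟨u, v, rfl, huv, by
            rw [hgC u hu, h.self v hvL]; exact fun he => hvg he.symm⟩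
      rintro _ ⟨u, v, rfl, huv, hne'⟩
      by_cases hu : u ∈ C <;> by_cases hv : v ∈ C
      · simp [hu, hv] at hne'
      · exact key u v huv hu hv
      · rw [Sym2.eq_swap (a := u)]
        exact key v u huv.symm hv hu
      · exact Or.inr ⟨u, v, rfl, huv, by simpa [hu, hv] using hne'⟩
    have h1 := Set.ncard_le_ncard hsub
    have h2 := Set.ncard_insert_le s(g i, x) (TreeQuery.crossing T g)
    have h3 := h.crossing
    omega
  · intro v hv
    rw [Set.mem_insert_iff, not_or] at hv
    rw [Function.update_of_ne (fun he : v = g i => hv.2 (he ▸ h.mem i))]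
    exact h.zero v hv.2
  · rintro t (rfl | ht)
    · rw [Function.update_of_ne (hne _ (h.mem t)), h.zero t hiL]
      exact Nat.zero_le _
    · have hsub : {v | T.Adj t v ∧ g v ≠ t} ⊆
          {v | T.Adj t v ∧ (if v ∈ C then i else g v) ≠ t} := by
        rintro v ⟨h1, h2⟩
        refine ⟨h1, ?_⟩
        split_ifs
        · exact hne t ht
        · exact h2
      by_cases htg : t = g i
      · subst htg
        rw [Function.update_self]
        have hxn : x ∉ {v | T.Adj (g i) v ∧ g v ≠ g i} := fun hx' => hx'.2 (hgC x hxC)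
        refine le_trans (Nat.succ_le_succ (h.le _ ht)) ?_
        rw [Nat.succ_eq_add_one, ← Set.ncard_insert_of_notMem hxn]
        refine Set.ncard_le_ncard (Set.insert_subset ⟨hx.symm, ?_⟩ hsub)
        simpa [hxC] using hne _ ht
      · rw [Function.update_of_ne htg]
        exact (h.le t ht).trans (Set.ncard_le_ncard hsub)
  · rw [hcard, ← h.sum, Finset.sum_update_of_mem (Finset.mem_univ _),
      ← Finset.add_sum_erase Finset.univ c (Finset.mem_univ (g i)), ← Finset.erase_eq]
    omega
  · rintro t ht hct D hD
    obtain ⟨D₀, hD₀, hDD⟩ := hsup hD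
    have hle := Set.ncard_le_ncard hDD
    have htg : t ≠ g i := by
      rintro rfl
      rw [Function.update_self] at hct
      omega
    rcases ht with rfl | ht
    · rw [fib_self]
      exact ⟨hle.trans (hmax D₀ hD₀), fun hDC => two_mul_ncard_le_of_sigma_min hT.isAcyclic
        hC.walkConnected hi hmin (hC.within hD hDC)⟩
    · rw [Function.update_of_ne htg] at hct
      rw [fib_old t ht htg]
      obtain ⟨h1, h2⟩ := h.size_zero t ht hct D₀ hD₀
      refine ⟨hle.trans h1, fun hDf => ?_⟩
      obtain ⟨y, hy⟩ := hD.nonempty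
      have := h2 fun z hz => (h.eq_of_mem hD₀ hz (hDD hy)).trans (hDf hy)
      omega
  · rintro t ht hct D hD
    obtain ⟨D₀, hD₀, hDD⟩ := hsup hD
    have hle := Set.ncard_le_ncard hDD
    rcases ht with rfl | ht
    · rw [Function.update_of_ne (hne _ (h.mem t)), h.zero t hiL] at hct
      omega
    · by_cases htg : t = g i
      · subst htg
        -- Before this step the part of `g i` was intact and at least as large as `D₀`. It loses
        -- `C`, at most half of it.
        rw [Function.update_self, Nat.add_eq_right] at hct
        have hCf : C ⊆ fibre g (g i) := fun v hv => hgC v hv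
        have h1 := (h.size_zero _ ht hct D₀ hD₀).1
        have h2 := (h.size_zero _ ht hct C hC).2 hCf
        have h3 := Set.ncard_sdiff_add_ncard_of_subset hCf
        rw [fib_par]
        omega
      · rw [Function.update_of_ne htg] at hct
        rw [fib_old t ht htg]
        exact hle.trans (h.size_one t ht hct D₀ hD₀)

end SelPartition

theorem SelRun.exists_selPartition [Fintype V] (hT : T.IsTree) {L : Set V} (h : SelRun T L)
    (hL : L.Nonempty) : ∃ g c, SelPartition T L g c := by
  classical
  induction h with
  | start => exact absurd rfl hL.ne_empty
  | @step L C i _ hC hmax hi hmin ih =>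
    rcases L.eq_empty_or_nonempty with rfl | hL'
    · exact ⟨_, _, by simpa using SelPartition.start hT hC hi hmin⟩
    · obtain ⟨g, c, h⟩ := ih hL'
      exact ⟨_, _, h.step hT hC hmax hi hmin⟩


/-! ### Choosing parts with few leaving edges -/

/-- Discarding an element of weight at least `q` keeps the average below `q`; once none is left, any
subset of the right size works. -/
theorem exists_subset_card_eq_sum_lt {ι : Type*} (s : Finset ι) (f : ι → ℕ) {q r : ℕ}
    (hr : 0 < r) (hrs : r ≤ s.card) (hs : ∑ t ∈ s, f t < q * s.card) :
    ∃ s' ⊆ s, s'.card = r ∧ ∑ t ∈ s', f t < q * r := by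
  classical
  obtain ⟨n, hn⟩ := Nat.exists_eq_add_of_le hrs
  induction n generalizing s with
  | zero => exact ⟨s, subset_rfl, by omega, by simpa [hn] using hs⟩
  | succ n ih =>
    by_cases h : ∃ t ∈ s, q ≤ f t
    · obtain ⟨t, ht, hqt⟩ := h
      have h1 := Finset.add_sum_erase s f ht
      have h2 := Finset.card_erase_add_one ht
      have h3 : q * s.card = q * (s.erase t).card + q := by rw [← h2]; ring
      obtain ⟨s', hs', h⟩ := ih (s.erase t) (by omega) (by omega) (by omega)
      exact ⟨s', hs'.trans (Finset.erase_subset _ _), h⟩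
    · push Not at h
      obtain ⟨s', hs', hc⟩ := Finset.exists_subset_card_eq hrs
      refine ⟨s', hs', hc, ?_⟩
      rw [← hc, mul_comm, ← smul_eq_mul, ← Finset.sum_const]
      exact Finset.sum_lt_sum_of_nonempty (Finset.card_pos.1 (by omega)) fun t ht => h t (hs' ht)

theorem ncard_boundary_biUnion_le [Finite V] {ι : Type*} (s : Finset ι) (f : ι → Set V) :
    (boundary T (⋃ t ∈ s, f t)).ncard ≤ ∑ t ∈ s, (boundary T (f t)).ncard := by
  refine le_trans (Set.ncard_le_ncard ?_) (Finset.set_ncard_biUnion_le s fun t => boundary T (f t))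
  rintro _ ⟨u, v, rfl, huv, hu, hv⟩
  simp only [Set.mem_iUnion, not_exists] at hu hv ⊢
  obtain ⟨t, ht, hu⟩ := hu
  exact ⟨t, ht, u, v, rfl, huv, hu, hv t ht⟩

theorem ncard_biUnion_fibre [Finite V] (s : Finset V) (g : V → V) :
    (⋃ t ∈ s, fibre g t).ncard = ∑ t ∈ s, (fibre g t).ncard := by
  classical
  cases nonempty_fintype V
  have h : (⋃ t ∈ s, fibre g t) = ((Finset.univ.filter fun v => g v ∈ s : Finset V) : Set V) := by
    ext v
    simp [fibre]
  rw [h, Set.ncard_coe_finset, Finset.card_eq_sum_card_fiberwise (f := g) (t := s)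
    (fun v hv => by simpa using hv)]
  refine Finset.sum_congr rfl fun t ht => ?_
  rw [← Set.ncard_coe_finset]
  congr 1
  ext v
  simp only [fibre, Finset.coe_filter, Finset.mem_filter, Finset.mem_univ, true_and,
    Set.mem_ofPred_eq]
  exact ⟨fun h => h.2, fun h => ⟨h ▸ ht, h⟩⟩

/-- Double counting: a crossing edge leaves at most two fibres. -/
theorem sum_ncard_boundary_fibre_le [Finite V] (s : Finset V) (g : V → V) :
    ∑ t ∈ s, (boundary T (fibre g t)).ncard ≤ 2 * (crossing T g).ncard := by
  classical
  let E := (crossing T g).toFinite.toFinset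
  have hE : (crossing T g).ncard = E.card := Set.ncard_eq_toFinset_card _ _
  have h1 : ∀ t ∈ s, (boundary T (fibre g t)).ncard =
      (Finset.bipartiteAbove (fun t e => e ∈ boundary T (fibre g t)) E t).card := by
    intro t _
    rw [← Set.ncard_coe_finset]
    congr 1
    ext e
    simp only [Finset.bipartiteAbove, Finset.coe_filter, E, Set.Finite.mem_toFinset,
      Set.mem_ofPred_eq]
    refine ⟨fun he => ⟨?_, he⟩, fun he => he.2⟩
    obtain ⟨u, v, rfl, huv, hu, hv⟩ := he
    exact ⟨u, v, rfl, huv, fun h => hv (h.symm.trans hu)⟩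
  rw [Finset.sum_congr rfl h1, Finset.sum_card_bipartiteAbove_eq_sum_card_bipartiteBelow, hE,
    mul_comm, ← smul_eq_mul, ← Finset.sum_const]
  refine Finset.sum_le_sum fun e he => ?_
  rw [Set.Finite.mem_toFinset] at he
  obtain ⟨u, v, rfl, -, -⟩ := he
  refine le_trans (Finset.card_le_card (t := {g u, g v}) ?_) Finset.card_le_two
  intro t ht
  obtain ⟨-, a, b, he, -, ha, -⟩ := Finset.mem_filter.1 ht
  rw [Sym2.eq_iff] at he
  have ha : g a = t := ha
  rcases he with ⟨rfl, -⟩ | ⟨-, rfl⟩ <;> simp [← ha]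

theorem SelPartition.le_ncard_boundary [Fintype V] {L : Set V} {g : V → V} {c : V → ℕ}
    (h : SelPartition T L g c) {t : V} (ht : t ∈ L) : c t ≤ (boundary T (fibre g t)).ncard := by
  refine (h.le t ht).trans (Set.ncard_le_ncard_of_injOn (fun v => s(t, v)) ?_ ?_)
  · rintro v ⟨h1, h2⟩
    exact ⟨t, v, rfl, h1, h.self t ht, h2⟩
  · intro v _ w _ hvw
    rcases Sym2.eq_iff.1 hvw with h | h
    · exact h.2
    · exact h.2.trans h.1

/-- The parts of the partition give large regions avoiding `L'` with few leaving edges. -/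
theorem SelPartition.exists_region [Fintype V] (hT : T.IsTree) {L L' : Set V} {g : V → V}
    {c : V → ℕ} (h : SelPartition T L g c) (hL : 4 * L'.ncard ≤ L.ncard) {k : ℕ} (hk : 0 < k)
    (hkL : k ≤ L'.ncard) :
    ∃ (R : Set V) (r : ℕ), Disjoint R L' ∧ (boundary T R).ncard ≤ 2 * k ∧ 0 < r ∧ k ≤ 2 * r ∧
      ∀ D, IsComponent T L D → r * D.ncard ≤ 2 * R.ncard := by
  classical
  let S : Finset V := L.toFinset
  have hS : S.card = L.ncard := (Set.ncard_eq_toFinset_card' L).symm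
  have hmS : ∀ {t}, t ∈ S ↔ t ∈ L := Set.mem_toFinset
  let d : V → ℕ := fun t => (boundary T (fibre g t)).ncard
  let A := S.filter fun t => c t ≤ 1
  let B := S.filter fun t => ¬ c t ≤ 1
  let G := A.filter fun t => Disjoint (fibre g t) L'
  let H := A.filter fun t => ¬ Disjoint (fibre g t) L'
  have cardAB : A.card + B.card = S.card := Finset.card_filter_add_card_filter_not _
  have cardGH : G.card + H.card = A.card := Finset.card_filter_add_card_filter_not _
  have sumAB : ∑ t ∈ A, d t + ∑ t ∈ B, d t = ∑ t ∈ S, d t :=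
    Finset.sum_filter_add_sum_filter_not _ _ _
  have sumGH : ∑ t ∈ G, d t + ∑ t ∈ H, d t = ∑ t ∈ A, d t :=
    Finset.sum_filter_add_sum_filter_not _ _ _
  have hBc : ∀ t ∈ B, 2 ≤ c t := fun t ht => by
    have := (Finset.mem_filter.1 ht).2
    omega
  have hBS : ∀ t ∈ B, t ∈ L := fun t ht => hmS.1 (Finset.mem_filter.1 ht).1
  have hAS : ∀ t ∈ A, t ∈ L := fun t ht => hmS.1 (Finset.mem_filter.1 ht).1
  have hB : B.card * 2 + 1 ≤ L.ncard := by
    rw [← h.sum]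
    exact Nat.succ_le_succ ((Finset.card_nsmul_le_sum B c 2 hBc).trans
      (Finset.sum_le_sum_of_subset (Finset.subset_univ _)))
  have hBd : B.card * 2 ≤ ∑ t ∈ B, d t := Finset.card_nsmul_le_sum B d 2 fun t ht =>
    (hBc t ht).trans (h.le_ncard_boundary (hBS t ht))
  have hHd : H.card * 1 ≤ ∑ t ∈ H, d t := by
    refine Finset.card_nsmul_le_sum H d 1 fun t ht => ?_
    have htL := hAS t (Finset.mem_filter.1 ht).1
    obtain ⟨w, hw, hwt⟩ := Set.exists_ne_of_one_lt_ncard (s := L) (by omega) t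
    exact one_le_ncard_boundary hT.connected ⟨t, h.self t htL⟩
      ⟨w, fun hw' => hwt ((h.self w hw).symm.trans hw')⟩
  have hHL : H.card ≤ L'.ncard := by
    have hex : ∀ t ∈ H, ∃ x ∈ L', g x = t := by
      intro t ht
      obtain ⟨x, hx, hxL⟩ := Set.not_disjoint_iff.1 (Finset.mem_filter.1 ht).2
      exact ⟨x, hxL, hx⟩
    choose! f hf hgf using hex
    rw [← Set.ncard_coe_finset]
    refine Set.ncard_le_ncard_of_injOn f (fun t ht => hf t ht) ?_
    intro t ht t' ht' he
    rw [← hgf t ht, ← hgf t' ht', he]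
  have hSd : ∑ t ∈ S, d t ≤ 2 * (TreeQuery.crossing T g).ncard := sum_ncard_boundary_fibre_le S g
  have hcr := h.crossing
  -- With $n=|L|$, the bounds $|B|\le(n-1)/2$ and $|H|\le n/4$ give $|G|>n/4\ge k$ and total
  -- boundary over `G` at most $2(n-1)-2|B|-|H|<3|G|$. For $r=\lceil k/2\rceil$, a sum below $3r$ is
  -- at most $2k$; strictness matters at $k=1$.
  obtain ⟨S', hS'G, hS'c, hS'd⟩ := exists_subset_card_eq_sum_lt G d (q := 3) (r := (k + 1) / 2)
    (by omega) (by omega) (by omega)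
  refine ⟨⋃ t ∈ S', fibre g t, (k + 1) / 2, ?_, ?_, by omega, by omega, ?_⟩
  · simp only [Set.disjoint_iUnion_left]
    exact fun t ht => (Finset.mem_filter.1 (hS'G ht)).2
  · have : (boundary T (⋃ t ∈ S', fibre g t)).ncard ≤ ∑ t ∈ S', d t :=
      ncard_boundary_biUnion_le S' (fibre g)
    omega
  · intro D hD
    rw [ncard_biUnion_fibre, ← hS'c, Finset.mul_sum]
    refine Finset.card_nsmul_le_sum S' _ _ fun t ht => ?_
    obtain ⟨htS, htc⟩ := Finset.mem_filter.1 (Finset.mem_filter.1 (hS'G ht)).1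
    rcases Nat.le_one_iff_eq_zero_or_eq_one.1 htc with h0 | h1
    · have := (h.size_zero t (hmS.1 htS) h0 D hD).1
      omega
    · exact h.size_one t (hmS.1 htS) h1 D hD

/-! ### Counting the mistakes -/

/-- No edge joins two different components, so a cut edge touches at most one of them. -/
theorem card_le_cutsize [Finite V] [Nonempty V] {S : Set V} {y : V → Bool} (s : Finset (Set V))
    (hs : ∀ C ∈ s, IsComponent T S C) (h : ∀ C ∈ s, ∃ u v, T.Adj u v ∧ y u ≠ y v ∧ u ∈ C) :
    s.card ≤ cutsize T y := by
  choose! u v huv hy hu using h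
  rw [← Set.ncard_coe_finset]
  refine Set.ncard_le_ncard_of_injOn (fun C => s(u C, v C)) ?_ ?_
  · intro C hC
    exact ⟨u C, v C, rfl, huv C hC, hy C hC⟩
  · intro C hC D hD he
    rw [Sym2.eq_iff] at he
    rcases he with he | he
    · exact (hs C hC).eq_of_mem (hs D hD) (hu C hC) (he.1 ▸ hu D hD)
    · have hadj := huv C hC
      rw [he.2] at hadj
      exact (hs C hC).eq_of_mem (hs D hD)
        ((hs C hC).mem_of_adj (hu C hC) ((hs D hD).notMem (hu D hD)) hadj) (hu D hD)

theorem card_le_ncard_of_not_disjoint [Finite V] [Nonempty V] {S L : Set V} (s : Finset (Set V))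
    (hs : ∀ C ∈ s, IsComponent T S C) (h : ∀ C ∈ s, ¬ Disjoint C L) : s.card ≤ L.ncard := by
  simp only [Set.not_disjoint_iff] at h
  choose! x hxC hxL using h
  rw [← Set.ncard_coe_finset]
  refine Set.ncard_le_ncard_of_injOn x hxL fun C hC D hD he => ?_
  exact (hs C hC).eq_of_mem (hs D hD) (hxC C hC) (he ▸ hxC D hD)

theorem mistakes_le [Finite V] (hT : T.IsTree) {K : ℕ} {Lsel : Set V} (hsel : SelRun T Lsel)
    {A : Predictor (plus T Lsel)} (hA : IsPred T (plus T Lsel) A) {L : Set V}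
    (hL : 8 * L.ncard ≤ (plus T Lsel).ncard) {y : V → Bool} (hy : cutsize T y ≤ K) :
    (mistakes (plus T Lsel) (A ((plus T Lsel).domRestrict y)) y : ℝ≥0∞) ≤
      10 * lowerBound T L K := by
  classical
  cases nonempty_fintype V
  have := hT.connected.nonempty
  rcases Lsel.eq_empty_or_nonempty with hemp | hne
  -- Without queries the whole tree is a region with no leaving edge, even for `K = 0`.
  · have hL0 : L = ∅ := by
      rw [← Set.ncard_eq_zero]
      rw [hemp, plus_empty, Set.ncard_empty] at hL
      omega
    calc (mistakes (plus T Lsel) (A ((plus T Lsel).domRestrict y)) y : ℝ≥0∞)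
        ≤ ((Set.univ : Set V).ncard : ℝ≥0∞) := by
          exact_mod_cast Set.ncard_le_ncard (Set.subset_univ _)
      _ ≤ 2 * lowerBound T L K := by
          refine ncard_le_two_mul_lowerBound hT (by simp [hL0]) ?_
          have : boundary T (Set.univ : Set V) = ∅ := by
            ext; simp [boundary]
          simp [this]
      _ ≤ 10 * lowerBound T L K := by
          gcongr
          norm_num
  have hQ : (plus T Lsel).Nonempty := hne.mono subset_plus
  have h4 : 4 * L.ncard ≤ Lsel.ncard := by
    have := ncard_plus_le hT Lsel
    omega
  let p := A ((plus T Lsel).domRestrict y)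
  let M : Finset (Set V) := Finset.univ.filter fun C =>
    IsComponent T (plus T Lsel) C ∧ ∃ i ∈ C, p i ≠ y i
  have hM : ∀ C ∈ M, IsComponent T (plus T Lsel) C ∧ ∃ i ∈ C, p i ≠ y i :=
    fun C hC => (Finset.mem_filter.1 hC).2
  have hMK : M.card ≤ K := by
    refine (card_le_cutsize M (fun C hC => (hM C hC).1) fun C hC => ?_).trans hy
    obtain ⟨h1, i, hi, herr⟩ := hM C hC
    exact exists_cut_of_error hT hA hQ (by rwa [IsHingeTree, plus_plus hT]) hi herr
  let U := M.filter fun C => Disjoint C L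
  let H := M.filter fun C => ¬ Disjoint C L
  have hUM : ∀ C ∈ U, C ∈ M := fun C hC => (Finset.mem_filter.1 hC).1
  have hHM : ∀ C ∈ H, C ∈ M := fun C hC => (Finset.mem_filter.1 hC).1
  have hUc : U.card ≤ M.card := Finset.card_filter_le _ _
  have hHc : H.card ≤ M.card := Finset.card_filter_le _ _
  have hHL : H.card ≤ L.ncard := card_le_ncard_of_not_disjoint H (fun C hC => (hM C (hHM C hC)).1)
    fun C hC => (Finset.mem_filter.1 hC).2
  have hmis : mistakes (plus T Lsel) p y ≤ (⋃ C ∈ U, C).ncard + ∑ C ∈ H, C.ncard := by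
    refine le_trans (Set.ncard_le_ncard (t := (⋃ C ∈ U, C) ∪ ⋃ C ∈ H, C) ?_)
      ((Set.ncard_union_le _ _).trans
        (Nat.add_le_add_left (Finset.set_ncard_biUnion_le H fun C => C) _))
    rintro i ⟨hi, herr⟩
    obtain ⟨C, hC, hiC⟩ := exists_isComponent (T := T) hi
    have hCM : C ∈ M := Finset.mem_filter.2 ⟨Finset.mem_univ _, hC, i, hiC, herr⟩
    by_cases hd : Disjoint C L
    · exact Or.inl (Set.mem_biUnion (x := C) (Finset.mem_filter.2 ⟨hCM, hd⟩) hiC)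
    · exact Or.inr (Set.mem_biUnion (x := C) (Finset.mem_filter.2 ⟨hCM, hd⟩) hiC)
  have hU : ((⋃ C ∈ U, C).ncard : ℝ≥0∞) ≤ 2 * lowerBound T L K := by
    refine ncard_le_two_mul_lowerBound hT ?_ ?_
    · simp only [Set.disjoint_iUnion_left]
      exact fun C hC => (Finset.mem_filter.1 hC).2
    · have h1 := ncard_boundary_biUnion_le (T := T) U fun C => C
      have h2 : ∑ C ∈ U, (boundary T C).ncard ≤ U.card * 2 := Finset.sum_le_card_nsmul U _ 2
        fun C hC => ncard_boundary_le_two hT (hM C (hUM C hC)).1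
      omega
  have hH : ((∑ C ∈ H, C.ncard : ℕ) : ℝ≥0∞) ≤ 8 * lowerBound T L K := by
    rcases Nat.eq_zero_or_pos H.card with h0 | hpos
    · simp [Finset.card_eq_zero.1 h0]
    · obtain ⟨g, c, hpart⟩ := hsel.exists_selPartition hT hne
      obtain ⟨R, r, hRL, hRb, hr, hkr, hRD⟩ := hpart.exists_region hT h4 hpos hHL
      have hR := ncard_le_two_mul_lowerBound hT (K := K) hRL (hRb.trans (by omega))
      -- With $k=|H|\le 2r$, the sum times $r$ is at most $k\cdot 2|R|\le 4r|R|$.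
      have hsum : ∑ C ∈ H, C.ncard ≤ 4 * R.ncard := by
        refine le_of_mul_le_mul_left (a := r) ?_ hr
        rw [Finset.mul_sum]
        have h1 : ∑ C ∈ H, r * C.ncard ≤ H.card * (2 * R.ncard) := by
          refine Finset.sum_le_card_nsmul H _ _ fun C hC => ?_
          obtain ⟨D, hD, hCD⟩ := (hM C (hHM C hC)).1.exists_superset subset_plus
          exact (Nat.mul_le_mul_left r (Set.ncard_le_ncard hCD)).trans (hRD D hD)
        nlinarith [Nat.mul_le_mul_right (2 * R.ncard) hkr]
      calc ((∑ C ∈ H, C.ncard : ℕ) : ℝ≥0∞) ≤ ((4 * R.ncard : ℕ) : ℝ≥0∞) := by exact_mod_cast hsum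
        _ = 4 * (R.ncard : ℝ≥0∞) := by push_cast; rfl
        _ ≤ 4 * (2 * lowerBound T L K) := by gcongr
        _ = 8 * lowerBound T L K := by rw [← mul_assoc]; norm_num
  calc (mistakes (plus T Lsel) p y : ℝ≥0∞)
      ≤ ((⋃ C ∈ U, C).ncard : ℝ≥0∞) + ((∑ C ∈ H, C.ncard : ℕ) : ℝ≥0∞) := by exact_mod_cast hmis
    _ ≤ 2 * lowerBound T L K + 8 * lowerBound T L K := add_le_add hU hH
    _ = 10 * lowerBound T L K := by rw [← add_mul]; norm_num

end TreeQuery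

theorem mainTheorem1 {V : Type*} [Finite V] (T : SimpleGraph V) (hT : T.IsTree) (K : ℕ)
    (Lsel : Set V) (hsel : TreeQuery.SelRun T Lsel)
    (A : TreeQuery.Predictor (TreeQuery.plus T Lsel))
    (hA : TreeQuery.IsPred T (TreeQuery.plus T Lsel) A)
    (L : Set V) (hL : (L.ncard : ℝ) ≤ ((TreeQuery.plus T Lsel).ncard : ℝ) / 8) :
    TreeQuery.worstMistakes T (TreeQuery.plus T Lsel) A K ≤ 10 * TreeQuery.lowerBound T L K := by
  have h8 : 8 * L.ncard ≤ (TreeQuery.plus T Lsel).ncard := by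
    rw [le_div_iff₀ (by norm_num)] at hL
    have : (8 * L.ncard : ℝ) ≤ (TreeQuery.plus T Lsel).ncard := by linarith
    exact_mod_cast this
  exact iSup₂_le fun y hy => TreeQuery.mistakes_le hT hsel hA h8 hy
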